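/- Let $R$ be a commutative Noetherian ring, $\mathfrak a$ an ideal of $R$, $X$ an $R$-module and $n$ a non-negative integer. For an $R$-module $Y$ put $\Gamma_{\mathfrak a}(Y)=\{y\in Y : \mathfrak a^k y=0 \text{ for some } k\ge 0\}$; $Y$ is called $\mathfrak a$-torsion if $\Gamma_{\mathfrak a}(Y)=Y$, and $H^i_{\mathfrak a}$ denotes the $i$-th right derived functor of $\Gamma_{\mathfrak a}$. Let $\mathcal M$ be a Melkersson subcategory with respect to $\mathfrak a$, that is, a Serre subcategory of the category of $R$-modules (a class of modules that contains $0$ and is closed under submodules, quotients and extensions) such that every $\mathfrak a$-torsion $R$-module $Y$ for which $0:_Y\mathfrak a=\{y\in Y:\mathfrak a y=0\}$ is in $\mathcal M$ is itself in $\mathcal M$. Then the following statements are equivalent: (i) $H^i_{\mathfrak a}(X)$ is in $\mathcal M$ for all $i$ with $0\le i\le n$; (ii) $\operatorname{Ext}^i_R(R/\mathfrak a,X)$ is in $\mathcal M$ for all $i$ with $0\le i\le n$. -/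

import Mathlib

open CategoryTheory

universe u

noncomputable section

section

variable {R : Type u} [CommRing R] (a : Ideal R)

/-- The `a`-torsion submodule `Γ_a(X)` of `X`: the elements killed by some power of `a`. -/
def gammaSubmodule (X : Type u) [AddCommGroup X] [Module R X] : Submodule R X where
  carrier := {x | ∃ k : ℕ, ∀ r ∈ a ^ k, r • x = 0}
  zero_mem' := ⟨0, fun r _ => smul_zero r⟩
  add_mem' := by
    rintro x y ⟨k, hk⟩ ⟨l, hl⟩
    refine ⟨max k l, fun r hr => ?_⟩
    rw [smul_add, hk r (Ideal.pow_le_pow_right (le_max_left k l) hr),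
      hl r (Ideal.pow_le_pow_right (le_max_right k l) hr), add_zero]
  smul_mem' := by
    rintro c x ⟨k, hk⟩
    exact ⟨k, fun r hr => by rw [smul_comm, hk r hr, smul_zero]⟩

/-- A linear map sends `a`-torsion elements to `a`-torsion elements. -/
theorem gammaSubmodule_map_mem {X Y : Type u} [AddCommGroup X] [Module R X]
    [AddCommGroup Y] [Module R Y] (f : X →ₗ[R] Y) {x : X} (hx : x ∈ gammaSubmodule a X) :
    f x ∈ gammaSubmodule a Y := by
  obtain ⟨k, hk⟩ := hx
  exact ⟨k, fun r hr => by rw [← map_smul, hk r hr, map_zero]⟩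

/-- The `a`-torsion functor `Γ_a`; on morphisms it is restriction. -/
def gammaFunctor : ModuleCat.{u} R ⥤ ModuleCat.{u} R where
  obj X := ModuleCat.of R (gammaSubmodule a X)
  map f := ModuleCat.ofHom (f.hom.restrict fun _ hx => gammaSubmodule_map_mem a f.hom hx)

instance gammaFunctor_additive : (gammaFunctor a).Additive where

/-- The `i`-th local cohomology functor `H^i_a`: the `i`-th right derived functor of `Γ_a`. -/
def localCohomologyFunctor (i : ℕ) : ModuleCat.{u} R ⥤ ModuleCat.{u} R :=
  (gammaFunctor a).rightDerived i

/-- The `R`-module `Ext^i_R(R/a, X)`. -/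
abbrev extQuotient (i : ℕ) (X : ModuleCat.{u} R) : ModuleCat.{u} R :=
  ModuleCat.of R (Abelian.Ext.{u} (ModuleCat.of R (R ⧸ a)) X i)

/-- `M` is a Melkersson subcategory with respect to `a`: a Serre subcategory of the category of
`R`-modules such that every `a`-torsion module `X` (that is, `Γ_a(X) = X`) with
`0 :_X a = {x ∈ X | a x = 0}` in `M` is itself in `M`. -/
structure IsMelkersson (M : ObjectProperty (ModuleCat.{u} R)) : Prop where
  isSerre : M.IsSerreClass
  mem_of_torsion : ∀ X : ModuleCat.{u} R, gammaSubmodule a X = ⊤ →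
    M (ModuleCat.of R (Submodule.torsionBySet R X (a : Set R))) → M X

end

end

/-! Induction on `n` by dimension shifting. In degree 0, `Hom(R/a, X)` is `0 :_X a`: it embeds in
`Γ_a(X)`, and the Melkersson condition applied to the torsion module `Γ_a(X)` gives the converse
(`IsMelkersson.prop_gammaSubmodule_iff`).

Once `Γ_a(X)` is in `M`, both sides ignore it in positive degrees. Passing to `X/Γ_a(X)` preserves
`H^{i+1}` because the kernel is torsion, and it preserves membership of `Ext` in `M` because all
`Ext^j(R/a, Γ_a(X))` lie in `M`. The torsion-free quotient embeds in an injective `J` with `Γ_a(J) =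
0`, so `Hom(R/a, J) = 0` as well. Hence the cokernel `C` of this embedding lowers both `H` and `Ext`
by one degree, even from 1 to 0 (`IsMelkersson.exists_shift`). The Noetherian input is Artin–Rees:
it makes `Γ_a(I)` injective for `I` injective, which yields `J = I/Γ_a(I)`. -/

section

open Limits

/-! ### Splicing injective resolutions -/

namespace CategoryTheory.InjectiveResolution

variable {C : Type*} [Category* C] [Abelian C] {X : C} (K : InjectiveResolution X)

/-- The coaugmentation `X ⟶ K⁰` of an injective resolution `K` of `X`. -/
def coaugmentation : X ⟶ K.cocomplex.X 0 := K.ι.f 0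

instance : Mono K.coaugmentation := inferInstanceAs (Mono (K.ι.f 0))

theorem coaugmentation_comp_d : K.coaugmentation ≫ K.cocomplex.d 0 1 = 0 :=
  K.ι_f_zero_comp_complex_d

theorem exact_coaugmentation :
    (ShortComplex.mk K.coaugmentation (K.cocomplex.d 0 1) K.coaugmentation_comp_d).Exact :=
  K.exact₀

/-- Splicing an injective resolution of `S.X₃` with a short exact sequence `S` whose middle term
is injective gives an injective resolution of `S.X₁`. -/
noncomputable def splice {S : ShortComplex C}
    (hS : S.ShortExact) [hI : Injective S.X₂] (K : InjectiveResolution S.X₃) :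
    InjectiveResolution S.X₁ :=
  have w : (S.g ≫ K.coaugmentation) ≫ K.cocomplex.d 0 1 = 0 := by
    rw [Category.assoc, coaugmentation_comp_d, comp_zero]
  have w' : S.f ≫ S.g ≫ K.coaugmentation = 0 := by rw [S.zero_assoc, zero_comp]
  { cocomplex := K.cocomplex.augment (S.g ≫ K.coaugmentation) w
    injective n := by
      cases n with
      | zero => exact hI
      | succ n => exact K.injective n
    ι := (CochainComplex.fromSingle₀Equiv _ _).symm ⟨S.f, w'⟩
    quasiIso := ⟨fun n => by
      have := hS.mono_f
      have := hS.epi_g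
      cases n with
      | zero =>
        rw [CochainComplex.quasiIsoAt₀_iff, ShortComplex.quasiIso_iff_of_zeros]
        -- Composing `S.g` with the monic coaugmentation keeps its kernel.
        · let T : ShortComplex C := ShortComplex.mk S.f (S.g ≫ K.coaugmentation) (by simp)
          have h : T.Exact ∧ Mono T.f :=
            ⟨(ShortComplex.exact_iff_of_epi_of_isIso_of_mono
              { τ₁ := 𝟙 _, τ₂ := 𝟙 _, τ₃ := K.coaugmentation : S ⟶ T}).1 hS.exact, hS.mono_f⟩
          refine (ShortComplex.exact_and_mono_f_iff_of_iso ?_).2 h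
          refine ShortComplex.isoMk (Iso.refl _) (Iso.refl _) (Iso.refl _) ?_ ?_
          · refine (Category.id_comp S.f).trans (Eq.trans ?_ (Category.comp_id _).symm)
            exact (CochainComplex.fromSingle₀Equiv_symm_apply_f_zero
              (C := K.cocomplex.augment (S.g ≫ K.coaugmentation) w) S.f w').symm
          · exact (Category.id_comp (S.g ≫ K.coaugmentation)).trans (Category.comp_id _).symm
        all_goals rfl
      | succ n =>
        rw [quasiIsoAt_iff_exactAt]
        · rw [HomologicalComplex.exactAt_iff' _ n (n + 1) (n + 1 + 1) (by simp) (by simp)]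
          cases n with
          | zero =>
            -- Precomposing with the epimorphism `S.g` keeps the image.
            exact (ShortComplex.exact_iff_of_epi_of_isIso_of_mono
              { τ₁ := S.g, τ₂ := 𝟙 _, τ₃ := 𝟙 _ :
                ShortComplex.mk (S.g ≫ K.coaugmentation) (K.cocomplex.d 0 1) w ⟶
                ShortComplex.mk K.coaugmentation (K.cocomplex.d 0 1) K.coaugmentation_comp_d}).2
              K.exact_coaugmentation
          | succ n => exact K.exact_succ n
        · apply CochainComplex.exactAt_succ_single_obj⟩ }

end CategoryTheory.InjectiveResolution

/-! ### Dimension shifting for right derived functors -/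

section RightDerived

variable {D : Type*} [Category* D] [Abelian D]

/-- By exactness `i` is the kernel of `g`, and `f ≫ i` lifts through it to `f`. -/
theorem nonempty_homology_comp_iso_cokernel {A K B E : D} (f : A ⟶ K) (i : K ⟶ B) (g : B ⟶ E)
    [Mono i] (wi : i ≫ g = 0) (hi : (ShortComplex.mk i g wi).Exact) (w : (f ≫ i) ≫ g = 0) :
    Nonempty ((ShortComplex.mk (f ≫ i) g w).homology ≅ cokernel f) := by
  have : Mono (ShortComplex.mk i g wi).f := inferInstance
  let hk : IsLimit (KernelFork.ofι i wi) := hi.fIsKernel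
  have hf : hk.lift (KernelFork.ofι (f ≫ i) w) = f := by
    rw [← cancel_mono i]
    exact hk.fac (KernelFork.ofι (f ≫ i) w) WalkingParallelPair.zero
  let h : (ShortComplex.mk (f ≫ i) g w).LeftHomologyData :=
    { K := K
      H := cokernel f
      i := i
      π := cokernel.π f
      wi := wi
      hi := hk
      wπ := by
        refine Eq.trans ?_ (cokernel.condition f)
        exact congrArg (· ≫ cokernel.π f) hf
      hπ := by
        refine CokernelCofork.IsColimit.ofπ _ _
          (fun k hk' => cokernel.desc f k ((congrArg (· ≫ k) hf).symm.trans hk'))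
          (fun k hk' => cokernel.π_desc _ _ _) (fun k hk' m hm => ?_)
        rw [← cancel_epi (cokernel.π f)]
        exact hm.trans (cokernel.π_desc _ _ _).symm }
  exact ⟨h.homologyIso⟩

variable {C : Type*} [Category* C] [Abelian C] [HasInjectiveResolutions C]
  (F : C ⥤ D) [F.Additive] {S : ShortComplex C} (hS : S.ShortExact) [Injective S.X₂]

include hS

/-- Dimension shifting for right derived functors in degrees at least two. -/
theorem nonempty_rightDerived_succ_succ_iso (n : ℕ) :
    Nonempty ((F.rightDerived (n + 2)).obj S.X₁ ≅ (F.rightDerived (n + 1)).obj S.X₃) := by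
  let K := injectiveResolution S.X₃
  let L := InjectiveResolution.splice hS K
  refine ⟨L.isoRightDerivedObj F (n + 2) ≪≫ ?_ ≪≫ (K.isoRightDerivedObj F (n + 1)).symm⟩
  refine HomologicalComplex.homologyIsoSc' _ (n + 1) (n + 2) (n + 3) (by simp) (by simp) ≪≫ ?_ ≪≫
    (HomologicalComplex.homologyIsoSc' _ n (n + 1) (n + 2) (by simp) (by simp)).symm
  exact Iso.refl _

/-- Dimension shifting for the first right derived functor of a left exact functor. -/
theorem nonempty_rightDerived_one_iso_cokernel [PreservesFiniteLimits F] :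
    Nonempty ((F.rightDerived 1).obj S.X₁ ≅ cokernel (F.map S.g)) := by
  let K := injectiveResolution S.X₃
  let L := InjectiveResolution.splice hS K
  have w : F.map K.coaugmentation ≫ F.map (K.cocomplex.d 0 1) = 0 := by
    rw [← F.map_comp, K.coaugmentation_comp_d, F.map_zero]
  have hi := K.exact_coaugmentation.map_of_mono_of_preservesKernel F inferInstance inferInstance
  obtain ⟨e⟩ := nonempty_homology_comp_iso_cokernel (F.map S.g) (F.map K.coaugmentation)
    (F.map (K.cocomplex.d 0 1)) w hi (by rw [Category.assoc, w, comp_zero])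
  refine ⟨L.isoRightDerivedObj F 1 ≪≫
    HomologicalComplex.homologyIsoSc' _ 0 1 2 (by simp) (by simp) ≪≫ ?_ ≪≫ e⟩
  let T : ShortComplex D :=
    ShortComplex.mk (F.map S.g ≫ F.map K.coaugmentation) (F.map (K.cocomplex.d 0 1))
      (by rw [Category.assoc, w, comp_zero])
  let T' : ShortComplex D :=
    ShortComplex.mk (F.map (S.g ≫ K.coaugmentation)) (F.map (K.cocomplex.d 0 1))
      (by rw [F.map_comp, Category.assoc, w, comp_zero])
  refine ShortComplex.homologyMapIso (S₁ := T') (S₂ := T)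
    (ShortComplex.isoMk (Iso.refl _) (Iso.refl _) (Iso.refl _) ?_ ?_)
  · exact (Category.id_comp T.f).trans
      ((F.map_comp S.g K.coaugmentation).symm.trans (Category.comp_id T'.f).symm)
  · exact (Category.id_comp T.g).trans (Category.comp_id _).symm

end RightDerived

end

/-! ### Torsion submodules over Noetherian rings -/

section Torsion

variable {R : Type u} [CommRing R] (a : Ideal R) {X Y : Type u} [AddCommGroup X] [Module R X]
  [AddCommGroup Y] [Module R Y]

theorem mem_gammaSubmodule_of_injective {f : X →ₗ[R] Y} (hf : Function.Injective f) {x : X}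
    (hx : f x ∈ gammaSubmodule a Y) : x ∈ gammaSubmodule a X := by
  obtain ⟨k, hk⟩ := hx
  exact ⟨k, fun r hr => hf (by rw [map_smul, hk r hr, map_zero])⟩

theorem gammaSubmodule_gammaSubmodule : gammaSubmodule a (gammaSubmodule a X) = ⊤ :=
  eq_top_iff.2 fun x _ =>
    mem_gammaSubmodule_of_injective a (gammaSubmodule a X).injective_subtype x.2

/-- A finitely generated submodule of the torsion submodule is killed by a power of `a`. -/
theorem exists_pow_smul_eq_zero_of_fg {N : Submodule R X} (hN : N.FG)
    (h : N ≤ gammaSubmodule a X) : ∃ m : ℕ, ∀ r ∈ a ^ m, ∀ x ∈ N, r • x = 0 := by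
  induction N, hN using Submodule.fg_induction with
  | singleton x =>
    obtain ⟨k, hk⟩ := h (Submodule.mem_span_singleton_self x)
    refine ⟨k, fun r hr y hy => ?_⟩
    obtain ⟨c, rfl⟩ := Submodule.mem_span_singleton.1 hy
    rw [smul_comm, hk r hr, smul_zero]
  | sup N₁ N₂ _ _ h₁ h₂ =>
    obtain ⟨k, hk⟩ := h₁ (le_sup_left.trans h)
    obtain ⟨l, hl⟩ := h₂ (le_sup_right.trans h)
    refine ⟨max k l, fun r hr y hy => ?_⟩
    obtain ⟨y₁, hy₁, y₂, hy₂, rfl⟩ := Submodule.mem_sup.1 hy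
    rw [smul_add, hk r (Ideal.pow_le_pow_right (le_max_left k l) hr) _ hy₁,
      hl r (Ideal.pow_le_pow_right (le_max_right k l) hr) _ hy₂, add_zero]

variable [IsNoetherianRing R]

/-- If `a ^ k` kills `f x`, then `a ^ k x` is a finitely generated submodule of the torsion kernel,
so some `a ^ m` kills it and `a ^ (m + k)` kills `x`. -/
theorem mem_gammaSubmodule_of_map_mem {f : X →ₗ[R] Y}
    (hf : LinearMap.ker f ≤ gammaSubmodule a X) {x : X} (hx : f x ∈ gammaSubmodule a Y) :
    x ∈ gammaSubmodule a X := by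
  obtain ⟨k, hk⟩ := hx
  have hN : (Submodule.map (LinearMap.toSpanSingleton R X x) (a ^ k)).FG :=
    (IsNoetherian.noetherian (a ^ k)).map _
  obtain ⟨m, hm⟩ := exists_pow_smul_eq_zero_of_fg a hN (by
    rintro _ ⟨r, hr, rfl⟩
    exact hf (by simpa using hk r hr))
  refine ⟨m + k, fun r hr => ?_⟩
  rw [pow_add] at hr
  refine Submodule.mul_induction_on hr (fun s hs t ht => ?_) (fun s t hs ht => ?_)
  · rw [mul_smul]
    exact hm s hs _ ⟨t, ht, rfl⟩
  · rw [add_smul, hs, ht, add_zero]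

variable (X)

theorem gammaSubmodule_quotient :
    gammaSubmodule a (X ⧸ gammaSubmodule a X) = ⊥ := by
  refine eq_bot_iff.2 fun y hy => ?_
  obtain ⟨x, rfl⟩ := Submodule.mkQ_surjective _ y
  exact (Submodule.Quotient.mk_eq_zero _).2
    (mem_gammaSubmodule_of_map_mem a (f := Submodule.mkQ _) (by simp) hy)

/-- Over a Noetherian ring the torsion submodule of an injective module is injective. -/
instance injective_gammaSubmodule [hX : Module.Injective R X] :
    Module.Injective R (gammaSubmodule a X) := by
  refine Module.Baer.injective fun J f => ?_
  have hfg : (LinearMap.range ((gammaSubmodule a X).subtype ∘ₗ f)).FG :=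
    LinearMap.range_eq_map ((gammaSubmodule a X).subtype ∘ₗ f) ▸
      (Module.Finite.fg_top (R := R) (M := J)).map _
  obtain ⟨m, hm⟩ := exists_pow_smul_eq_zero_of_fg a hfg (by
    rintro _ ⟨j, rfl⟩
    exact (f j).2)
  have hm' : ∀ r ∈ a ^ m, ∀ j, r • f j = 0 := fun r hr j =>
    Subtype.ext (hm r hr _ ⟨j, rfl⟩)
  -- Artin–Rees: `f` vanishes on `J ∩ a ^ (m + k)`, so it factors through the image of `J` in `R/a ^
  -- (m + k)`. Any extension to that quotient has torsion values.
  obtain ⟨k, hk⟩ := Ideal.exists_pow_inf_eq_pow_smul a J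
  have hle : a ^ (m + k) ⊓ J ≤ a ^ m • J := by
    have := hk (m + k) (Nat.le_add_left k m)
    rw [smul_eq_mul, Ideal.mul_top, Nat.add_sub_cancel] at this
    rw [this]
    exact Submodule.smul_mono le_rfl inf_le_right
  have hzero : ∀ x : J, (x : R) ∈ a ^ (m + k) → f x = 0 := by
    intro x hx
    have key : ∀ y ∈ a ^ m • J, ∃ h : y ∈ J, f ⟨y, h⟩ = 0 := by
      intro y hy
      refine Submodule.smul_induction_on hy (fun r hr j hj => ⟨J.smul_mem r hj, ?_⟩) ?_
      · exact (f.map_smul r ⟨j, hj⟩).trans (hm' r hr _)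
      · rintro y z ⟨hy, hy'⟩ ⟨hz, hz'⟩
        refine ⟨J.add_mem hy hz, (f.map_add ⟨y, hy⟩ ⟨z, hz⟩).trans ?_⟩
        rw [hy', hz', add_zero]
    exact (key x (hle ⟨hx, x.2⟩)).2
  let g : J →ₗ[R] R ⧸ a ^ (m + k) := (Submodule.mkQ (a ^ (m + k))) ∘ₗ J.subtype
  have hker : LinearMap.ker g ≤ LinearMap.ker f := fun x hx =>
    hzero x ((Submodule.Quotient.mk_eq_zero _).1 hx)
  let f' : LinearMap.range g →ₗ[R] gammaSubmodule a X :=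
    (LinearMap.ker g).liftQ f hker ∘ₗ g.quotKerEquivRange.symm.toLinearMap
  obtain ⟨h, hh⟩ := hX.out (LinearMap.range g).subtype (Submodule.injective_subtype _)
    ((gammaSubmodule a X).subtype ∘ₗ f')
  refine ⟨(h ∘ₗ Submodule.mkQ (a ^ (m + k))).codRestrict _ fun r =>
    ⟨m + k, fun s hs => ?_⟩, fun x hx => Subtype.ext ?_⟩
  · rw [← map_smul]
    have : Submodule.mkQ (a ^ (m + k)) (s • r) = 0 :=
      (Submodule.Quotient.mk_eq_zero _).2 (Ideal.mul_mem_right _ _ hs)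
    rw [LinearMap.comp_apply, this, map_zero]
  · refine (hh ⟨g ⟨x, hx⟩, ⟨x, hx⟩, rfl⟩).trans ?_
    have : g.quotKerEquivRange.symm ⟨g ⟨x, hx⟩, ⟨x, hx⟩, rfl⟩ =
        (LinearMap.ker g).mkQ ⟨x, hx⟩ := by
      rw [LinearEquiv.symm_apply_eq]
      rfl
    simp [f', this]

/-- The injective submodule `Γ_a(X)` splits off, so the quotient is a direct summand of `X`. -/
instance injective_quotient_gammaSubmodule [hX : Module.Injective R X] :
    Module.Injective R (X ⧸ gammaSubmodule a X) := by
  obtain ⟨ρ, hρ⟩ := (injective_gammaSubmodule a X).out (gammaSubmodule a X).subtype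
    (Submodule.injective_subtype _) LinearMap.id
  let s : X ⧸ gammaSubmodule a X →ₗ[R] X := (gammaSubmodule a X).liftQ
    (LinearMap.id - (gammaSubmodule a X).subtype ∘ₗ ρ) (fun x hx => by
      have := hρ ⟨x, hx⟩
      simp only [Submodule.subtype_apply, LinearMap.id_apply] at this
      simp [this])
  have hs : ∀ y, (gammaSubmodule a X).mkQ (s y) = y := by
    intro y
    obtain ⟨x, rfl⟩ := Submodule.mkQ_surjective _ y
    simp [s]
  refine ⟨fun A B _ _ _ _ f hf g => ?_⟩
  obtain ⟨h, hh⟩ := hX.out f hf (s ∘ₗ g)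
  exact ⟨(gammaSubmodule a X).mkQ ∘ₗ h, fun x => by simp [hh, hs, -Submodule.mkQ_apply]⟩

end Torsion

/-! ### Local cohomology -/

section LocalCohomology

variable {R : Type u} [CommRing R] (a : Ideal R)

/-- An injective linear map `f : X → I`, seen as the short exact sequence `0 → X → I → I / X → 0`. -/
abbrev quotientSequence {X I : Type u} [AddCommGroup X] [Module R X] [AddCommGroup I] [Module R I]
    (f : X →ₗ[R] I) : ShortComplex (ModuleCat.{u} R) :=
  ModuleCat.shortComplexOfCompEqZero f (LinearMap.range f).mkQ (LinearMap.range_mkQ_comp f)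

theorem shortExact_quotientSequence {X I : Type u} [AddCommGroup X] [Module R X] [AddCommGroup I]
    [Module R I] {f : X →ₗ[R] I} (hf : Function.Injective f) : (quotientSequence f).ShortExact :=
  ModuleCat.shortComplex_shortExact _ (LinearMap.exact_map_mkQ_range f) hf
    (Submodule.mkQ_surjective _)

theorem exists_injective_linearMap (X : Type u) [AddCommGroup X] [Module R X] :
    ∃ (I : ModuleCat.{u} R) (f : X →ₗ[R] I), Module.Injective R I ∧ Function.Injective f := by
  let I : ModuleCat.{u} R := Injective.under (ModuleCat.of R X)
  have : CategoryTheory.Injective (ModuleCat.of R I) :=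
    Injective.injective_under (ModuleCat.of R X)
  exact ⟨I, (Injective.ι (ModuleCat.of R X)).hom, Module.injective_module_of_injective_object R I,
    (ModuleCat.mono_iff_injective _).1 (Injective.ι_mono _)⟩

instance : Limits.PreservesFiniteLimits (gammaFunctor a) := by
  refine (Functor.preservesFiniteLimits_iff_forall_exact_map_and_mono _).2 fun S hS => ⟨?_, ?_⟩
  · rw [ShortComplex.moduleCat_exact_iff]
    rintro ⟨x, hx⟩ h
    obtain ⟨y, rfl⟩ := (ShortComplex.moduleCat_exact_iff S).1 hS.exact x (congrArg Subtype.val h)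
    exact ⟨⟨y, mem_gammaSubmodule_of_injective a hS.moduleCat_injective_f hx⟩, rfl⟩
  · rw [ModuleCat.mono_iff_injective]
    exact fun x y h => Subtype.ext (hS.moduleCat_injective_f (congrArg Subtype.val h))

theorem nonempty_localCohomology_zero_iso (X : ModuleCat.{u} R) :
    Nonempty ((localCohomologyFunctor a 0).obj X ≅ ModuleCat.of R (gammaSubmodule a X)) :=
  ⟨(gammaFunctor a).rightDerivedZeroIsoSelf.app X⟩

section

variable {X I : Type u} [AddCommGroup X] [Module R X] [AddCommGroup I] [Module R I]
  [hI : Module.Injective R I] {f : X →ₗ[R] I} (hf : Function.Injective f)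

include hf

theorem nonempty_localCohomology_succ_succ_iso (n : ℕ) :
    Nonempty ((localCohomologyFunctor a (n + 2)).obj (ModuleCat.of R X) ≅
      (localCohomologyFunctor a (n + 1)).obj (ModuleCat.of R (I ⧸ LinearMap.range f))) :=
  have : Injective (quotientSequence f).X₂ := Module.injective_object_of_injective_module R I
  nonempty_rightDerived_succ_succ_iso (gammaFunctor a) (shortExact_quotientSequence hf) n

/-- The map on torsion submodules induced by a linear map. -/
def gammaMap {X Y : Type u} [AddCommGroup X] [Module R X] [AddCommGroup Y] [Module R Y]
    (g : X →ₗ[R] Y) : gammaSubmodule a X →ₗ[R] gammaSubmodule a Y :=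
  g.restrict fun _ hx => gammaSubmodule_map_mem a g hx

theorem nonempty_localCohomology_one_iso :
    Nonempty ((localCohomologyFunctor a 1).obj (ModuleCat.of R X) ≅
      ModuleCat.of R (gammaSubmodule a (I ⧸ LinearMap.range f) ⧸
        LinearMap.range (gammaMap a (LinearMap.range f).mkQ))) :=
  have : Injective (quotientSequence f).X₂ := Module.injective_object_of_injective_module R I
  (nonempty_rightDerived_one_iso_cokernel (gammaFunctor a)
    (shortExact_quotientSequence hf)).map fun e => e ≪≫ ModuleCat.cokernelIsoRangeQuotient _

end

/-- Since `Γ_a(J) = 0`, the cokernel describing `H^1` is all of `Γ_a(J/X)`, so the shift also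
reaches degree 0. -/
theorem nonempty_localCohomology_succ_iso (n : ℕ) {X J : Type u} [AddCommGroup X] [Module R X]
    [AddCommGroup J] [Module R J] [Module.Injective R J] (hJ : gammaSubmodule a J = ⊥)
    {f : X →ₗ[R] J} (hf : Function.Injective f) :
    Nonempty ((localCohomologyFunctor a (n + 1)).obj (ModuleCat.of R X) ≅
      (localCohomologyFunctor a n).obj (ModuleCat.of R (J ⧸ LinearMap.range f))) := by
  cases n with
  | zero =>
    obtain ⟨e₁⟩ := nonempty_localCohomology_one_iso a hf
    obtain ⟨e₂⟩ := nonempty_localCohomology_zero_iso a (ModuleCat.of R (J ⧸ LinearMap.range f))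
    refine ⟨e₁ ≪≫ (Submodule.quotEquivOfEqBot _ ?_).toModuleIso ≪≫ e₂.symm⟩
    rw [eq_bot_iff]
    rintro _ ⟨⟨x, hx⟩, rfl⟩
    rw [hJ, Submodule.mem_bot] at hx
    subst hx
    exact map_zero (gammaMap a (LinearMap.range f).mkQ)
  | succ n => exact nonempty_localCohomology_succ_succ_iso a hf n

variable [IsNoetherianRing R]

/-- Local cohomology in positive degrees does not change under a surjection with torsion kernel. -/
theorem nonempty_localCohomology_iso_of_surjective (n : ℕ) {X Y : Type u} [AddCommGroup X]
    [Module R X] [AddCommGroup Y] [Module R Y] (g : X →ₗ[R] Y) (hg : Function.Surjective g)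
    (hker : LinearMap.ker g ≤ gammaSubmodule a X) :
    Nonempty ((localCohomologyFunctor a (n + 1)).obj (ModuleCat.of R X) ≅
      (localCohomologyFunctor a (n + 1)).obj (ModuleCat.of R Y)) := by
  obtain ⟨I, i, hI, hi⟩ := exists_injective_linearMap (R := R) (LinearMap.ker g)
  obtain ⟨F, j, hF, hj⟩ := exists_injective_linearMap (R := R) Y
  obtain ⟨e, he⟩ := (injective_gammaSubmodule a I).out (LinearMap.ker g).subtype
    (Submodule.injective_subtype _) (i.codRestrict (gammaSubmodule a I) fun x =>
      gammaSubmodule_map_mem a i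
        (mem_gammaSubmodule_of_injective a (Submodule.injective_subtype _) (hker x.2)))
  -- Horseshoe-style embedding with a torsion first factor. The induced map `ψ` of cokernels is
  -- again surjective with torsion kernel, which permits recursion on `n`.
  let φ : X →ₗ[R] gammaSubmodule a I × F := e.prod (j ∘ₗ g)
  have hφ : Function.Injective φ := by
    rw [← LinearMap.ker_eq_bot, LinearMap.ker_eq_bot']
    intro x hx
    have h1 : e x = 0 := congrArg Prod.fst hx
    have h2 : g x = 0 := hj ((congrArg Prod.snd hx).trans (map_zero j).symm)
    have h3 : i ⟨x, h2⟩ = 0 := congrArg Subtype.val ((he ⟨x, h2⟩).symm.trans h1)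
    exact congrArg Subtype.val (hi (h3.trans (map_zero i).symm))
  have hinj : Module.Injective R (gammaSubmodule a I × F) := by
    refine ⟨fun A B _ _ _ _ f hf g => ?_⟩
    obtain ⟨h₁, hh₁⟩ := (injective_gammaSubmodule a I).out f hf (LinearMap.fst R _ _ ∘ₗ g)
    obtain ⟨h₂, hh₂⟩ := hF.out f hf (LinearMap.snd R _ _ ∘ₗ g)
    exact ⟨h₁.prod h₂, fun x => Prod.ext (hh₁ x) (hh₂ x)⟩
  let ψ : ((gammaSubmodule a I × F) ⧸ LinearMap.range φ) →ₗ[R] F ⧸ LinearMap.range j :=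
    Submodule.mapQ _ _ (LinearMap.snd R _ _) (by
      rintro _ ⟨x, rfl⟩
      exact ⟨g x, rfl⟩)
  have hψ : Function.Surjective ψ := by
    intro y
    obtain ⟨y, rfl⟩ := Submodule.mkQ_surjective _ y
    exact ⟨Submodule.mkQ _ (0, y), rfl⟩
  have hlift : ∀ q, ∀ f : F, ψ q = Submodule.mkQ _ f →
      ∃ t : gammaSubmodule a I, q = Submodule.mkQ _ (t, f) := by
    intro q f hq
    obtain ⟨⟨t, f'⟩, rfl⟩ := Submodule.mkQ_surjective _ q
    obtain ⟨y, hy⟩ := (Submodule.Quotient.eq _).1 hq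
    obtain ⟨x, rfl⟩ := hg y
    refine ⟨t - e x, (Submodule.Quotient.eq _).2 ⟨x, Prod.ext ?_ hy⟩⟩
    simp [φ]
  have htors : ∀ (t : gammaSubmodule a I) (f : F), f ∈ gammaSubmodule a F →
      (t, f) ∈ gammaSubmodule a (gammaSubmodule a I × F) := by
    intro t f hf
    refine mem_gammaSubmodule_of_map_mem a (f := LinearMap.snd R _ _) ?_ hf
    rintro ⟨s, f⟩ (rfl : f = 0)
    exact gammaSubmodule_map_mem a (LinearMap.inl R (gammaSubmodule a I) F)
      (gammaSubmodule_gammaSubmodule a (X := I) ▸ Submodule.mem_top : s ∈ _)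
  have hψker : LinearMap.ker ψ ≤ gammaSubmodule a _ := by
    intro q hq
    obtain ⟨t, rfl⟩ := hlift q 0 (by simpa using hq)
    exact gammaSubmodule_map_mem a _ (htors t 0 (zero_mem _))
  cases n with
  | zero =>
    obtain ⟨e₁⟩ := nonempty_localCohomology_one_iso a hφ
    obtain ⟨e₂⟩ := nonempty_localCohomology_one_iso a hj
    let π := (LinearMap.range (gammaMap a (LinearMap.range j).mkQ)).mkQ ∘ₗ gammaMap a ψ
    have hπ : Function.Surjective π := by
      refine (Submodule.mkQ_surjective _).comp ?_
      rintro ⟨y, hy⟩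
      obtain ⟨q, rfl⟩ := hψ y
      exact ⟨⟨q, mem_gammaSubmodule_of_map_mem a hψker hy⟩, rfl⟩
    have hπker : LinearMap.range (gammaMap a (LinearMap.range φ).mkQ) = LinearMap.ker π := by
      ext ⟨q, hq⟩
      constructor
      · rintro ⟨⟨⟨t, f⟩, h⟩, hq'⟩
        refine (Submodule.Quotient.mk_eq_zero _).2
          ⟨⟨f, gammaSubmodule_map_mem a (LinearMap.snd R _ _) h⟩, ?_⟩
        rw [← hq']
        rfl
      · intro h
        obtain ⟨⟨f, hf⟩, hq'⟩ := (Submodule.Quotient.mk_eq_zero _).1 h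
        obtain ⟨t, rfl⟩ := hlift q f (congrArg Subtype.val hq').symm
        exact ⟨⟨(t, f), htors t f hf⟩, rfl⟩
    exact ⟨e₁ ≪≫ ((Submodule.quotEquivOfEq _ _ hπker).trans
      (π.quotKerEquivOfSurjective hπ)).toModuleIso ≪≫ e₂.symm⟩
  | succ n =>
    obtain ⟨e₁⟩ := nonempty_localCohomology_succ_succ_iso a hφ n
    obtain ⟨e₂⟩ := nonempty_localCohomology_succ_succ_iso a hj n
    obtain ⟨e₃⟩ := nonempty_localCohomology_iso_of_surjective n ψ hψ hψker
    exact ⟨e₁ ≪≫ e₃ ≪≫ e₂.symm⟩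

/-- A module without torsion embeds into an injective module without torsion. -/
theorem exists_injective_linearMap_of_gammaSubmodule_eq_bot {X : Type u} [AddCommGroup X]
    [Module R X] (hX : gammaSubmodule a X = ⊥) :
    ∃ (J : ModuleCat.{u} R) (f : X →ₗ[R] J), Module.Injective R J ∧ gammaSubmodule a J = ⊥ ∧
      Function.Injective f := by
  obtain ⟨I, i, hI, hi⟩ := exists_injective_linearMap (R := R) X
  refine ⟨ModuleCat.of R (I ⧸ gammaSubmodule a I), (gammaSubmodule a I).mkQ ∘ₗ i,
    injective_quotient_gammaSubmodule a I, gammaSubmodule_quotient a I, ?_⟩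
  rw [← LinearMap.ker_eq_bot, eq_bot_iff, ← hX]
  exact fun x hx =>
    mem_gammaSubmodule_of_injective a hi ((Submodule.Quotient.mk_eq_zero _).1 hx)

end LocalCohomology

/-! ### Serre classes of modules -/

section SerreClass

variable {R : Type u} [CommRing R] {M : ObjectProperty (ModuleCat.{u} R)} [M.IsSerreClass]

namespace CategoryTheory.ObjectProperty

variable {A B C : Type u} [AddCommGroup A] [Module R A] [AddCommGroup B] [Module R B]
  [AddCommGroup C] [Module R C]

theorem prop_of_linearMap_injective {f : A →ₗ[R] B} (hf : Function.Injective f)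
    (hB : M (ModuleCat.of R B)) : M (ModuleCat.of R A) :=
  have : Mono (ModuleCat.ofHom f) := (ModuleCat.mono_iff_injective _).2 hf
  M.prop_of_mono (ModuleCat.ofHom f) hB

theorem prop_of_linearMap_surjective {f : A →ₗ[R] B} (hf : Function.Surjective f)
    (hA : M (ModuleCat.of R A)) : M (ModuleCat.of R B) :=
  have : Epi (ModuleCat.ofHom f) := (ModuleCat.epi_iff_surjective _).2 hf
  M.prop_of_epi (ModuleCat.ofHom f) hA

theorem prop_of_linearMap_exact {f : A →ₗ[R] B} {g : B →ₗ[R] C} (h : ∀ x, g x = 0 → ∃ y, f y = x)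
    (hA : M (ModuleCat.of R A)) (hC : M (ModuleCat.of R C)) : M (ModuleCat.of R B) := by
  have hker : M (ModuleCat.of R (LinearMap.ker g)) :=
    prop_of_linearMap_injective (f := Submodule.inclusion (fun x hx => h x hx :
      LinearMap.ker g ≤ LinearMap.range f)) (Submodule.inclusion_injective _)
      (prop_of_linearMap_surjective f.surjective_rangeRestrict hA)
  have hrange : M (ModuleCat.of R (LinearMap.range g)) :=
    prop_of_linearMap_injective (LinearMap.range g).injective_subtype hC
  refine M.prop_X₂_of_shortExact
    (LinearMap.shortExact_shortComplexKer g.surjective_rangeRestrict) ?_ hrange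
  exact prop_of_linearMap_injective
    (Submodule.inclusion_injective (LinearMap.ker_rangeRestrict g).le) hker

end CategoryTheory.ObjectProperty

theorem prop_pi_fin {N : ModuleCat.{u} R} (hN : M N) (k : ℕ) :
    M (ModuleCat.of R (Fin k → N)) := by
  induction k with
  | zero => exact M.prop_of_isZero (ModuleCat.isZero_of_subsingleton _)
  | succ k ih =>
    refine M.prop_of_linearMap_exact (f := LinearMap.single R (fun _ : Fin (k + 1) => (N : Type u)) 0)
      (g := LinearMap.funLeft R N Fin.succ) (fun x hx => ⟨x 0, ?_⟩) hN ih
    funext i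
    refine Fin.cases (by simp) (fun i => ?_) i
    simpa using (congrFun hx i).symm

end SerreClass

/-! ### Ext and Serre classes -/

section Ext

open Abelian

variable {R : Type u} [CommRing R] {M : ObjectProperty (ModuleCat.{u} R)} [M.IsSerreClass]

/-- `Ext⁰` is `Hom`, linearly. -/
noncomputable def extZeroLinearEquiv (L N : ModuleCat.{u} R) : Ext.{u} L N 0 ≃ₗ[R] (L →ₗ[R] N) :=
  (Ext.linearEquiv₀ (R := R)).trans ModuleCat.homLinearEquiv

/-- `Hom(L, N)` embeds in a finite power of `N`. In higher degrees, `Ext^{i+1}(L, N)` is a quotient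
of `Ext^i` of a syzygy of `L`, finitely generated as `R` is Noetherian. -/
theorem prop_ext_of_finite [IsNoetherianRing R] {N : ModuleCat.{u} R} (hN : M N) (i : ℕ)
    (L : ModuleCat.{u} R) [Module.Finite R L] : M (ModuleCat.of R (Ext.{u} L N i)) := by
  induction i generalizing L with
  | zero =>
    obtain ⟨k, π, hπ⟩ := Module.Finite.exists_fin' R L
    let ev : (L →ₗ[R] N) →ₗ[R] Fin k → N :=
      LinearMap.pi fun j => LinearMap.applyₗ (π (Pi.single j 1))
    refine M.prop_of_linearMap_injective (f := ev ∘ₗ (extZeroLinearEquiv L N).toLinearMap) ?_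
      (prop_pi_fin hN k)
    refine Function.Injective.comp (g := ev) (f := extZeroLinearEquiv L N) (fun φ ψ h => ?_)
      (extZeroLinearEquiv L N).injective
    have : φ ∘ₗ π = ψ ∘ₗ π := by
      refine LinearMap.pi_ext' fun j => LinearMap.ext_ring ?_
      simpa [ev] using congrFun h j
    exact LinearMap.ext fun x => by
      obtain ⟨y, rfl⟩ := hπ x
      exact LinearMap.congr_fun this y
  | succ i ih =>
    obtain ⟨k, π, hπ⟩ := Module.Finite.exists_fin' R L
    have hS := LinearMap.shortExact_shortComplexKer hπ
    have : Projective π.shortComplexKer.X₂ :=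
      inferInstanceAs (Projective (ModuleCat.of R (Fin k → R)))
    have : Module.Finite R π.shortComplexKer.X₁ :=
      inferInstanceAs (Module.Finite R (LinearMap.ker π))
    exact M.prop_of_linearMap_surjective
      (f := hS.extClass.precompOfLinear R N (add_comm 1 i))
      (precomp_extClass_surjective_of_projective_X₂ N hS i) (ih _)

theorem prop_ext_iff_of_shortExact {S : ShortComplex (ModuleCat.{u} R)} (hS : S.ShortExact)
    (L : ModuleCat.{u} R) (h : ∀ i, M (ModuleCat.of R (Ext.{u} L S.X₁ i))) (i : ℕ) :
    M (ModuleCat.of R (Ext.{u} L S.X₂ i)) ↔ M (ModuleCat.of R (Ext.{u} L S.X₃ i)) := by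
  constructor
  · intro h₂
    exact M.prop_of_linearMap_exact (f := (Ext.mk₀ S.g).postcompOfLinear R L (add_zero i))
      (g := hS.extClass.postcompOfLinear R L rfl)
      (fun x hx => Ext.covariant_sequence_exact₃ L hS x rfl hx) h₂ (h (i + 1))
  · intro h₃
    exact M.prop_of_linearMap_exact (f := (Ext.mk₀ S.f).postcompOfLinear R L (add_zero i))
      (g := (Ext.mk₀ S.g).postcompOfLinear R L (add_zero i))
      (fun x hx => Ext.covariant_sequence_exact₂ L hS x hx) (h i) h₃

/-- `h₀` is needed only for `i = 0`; injectivity of `S.X₂` kills its `Ext` in positive degrees. -/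
theorem nonempty_ext_succ_iso {S : ShortComplex (ModuleCat.{u} R)} (hS : S.ShortExact)
    (L : ModuleCat.{u} R) [Injective S.X₂] (h₀ : ∀ x : Ext.{u} L S.X₂ 0, x = 0) (i : ℕ) :
    Nonempty (ModuleCat.of R (Ext.{u} L S.X₁ (i + 1)) ≅ ModuleCat.of R (Ext.{u} L S.X₃ i)) := by
  have h : ∀ x : Ext.{u} L S.X₂ i, x = 0 := by
    cases i with
    | zero => exact h₀
    | succ i => exact Ext.eq_zero_of_injective
  refine ⟨(LinearEquiv.ofBijective (hS.extClass.postcompOfLinear R L rfl)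
    ⟨?_, postcomp_extClass_surjective_of_projective_X₂ hS L i⟩).toModuleIso.symm⟩
  rw [← LinearMap.ker_eq_bot, LinearMap.ker_eq_bot']
  intro x hx
  obtain ⟨y, rfl⟩ := Ext.covariant_sequence_exact₃ L hS x rfl hx
  rw [h y, Ext.zero_comp]

end Ext

/-! ### Melkersson subcategories -/

section Melkersson

open Abelian

variable {R : Type u} [CommRing R] (a : Ideal R)

/-- The image of a map from `R/a` is killed by `a`, hence torsion. -/
theorem ext_quotient_zero_eq_zero {J : ModuleCat.{u} R} (hJ : gammaSubmodule a J = ⊥)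
    (x : Ext.{u} (ModuleCat.of R (R ⧸ a)) J 0) : x = 0 := by
  refine (extZeroLinearEquiv _ _).map_eq_zero_iff.1 (LinearMap.ext fun y => ?_)
  refine (Submodule.mem_bot R).1 (hJ ▸ gammaSubmodule_map_mem a _ ⟨1, fun r hr => ?_⟩)
  rw [pow_one] at hr
  obtain ⟨y, rfl⟩ := Submodule.mkQ_surjective _ y
  exact (Submodule.Quotient.mk_eq_zero _).2 (Ideal.mul_mem_right _ _ hr)

variable {a} {M : ObjectProperty (ModuleCat.{u} R)} (hM : IsMelkersson a M)
include hM

theorem IsMelkersson.prop_gammaSubmodule_iff (X : ModuleCat.{u} R) :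
    M (ModuleCat.of R (gammaSubmodule a X)) ↔ M (extQuotient a 0 X) := by
  have := hM.isSerre
  let e := extZeroLinearEquiv (ModuleCat.of R (R ⧸ a)) X
  constructor
  · intro h
    let ev : ((R ⧸ a) →ₗ[R] X) →ₗ[R] gammaSubmodule a X :=
      (LinearMap.applyₗ (Submodule.Quotient.mk 1 : R ⧸ a)).codRestrict _ fun φ =>
        gammaSubmodule_map_mem a φ ⟨1, fun r hr => (Submodule.Quotient.mk_eq_zero _).2
          (Ideal.mul_mem_right _ _ (by simpa using hr))⟩
    refine M.prop_of_linearMap_injective (f := ev ∘ₗ e.toLinearMap) ?_ h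
    refine Function.Injective.comp (g := ev) (f := e) (fun φ ψ h => ?_) e.injective
    refine LinearMap.ext fun y => ?_
    obtain ⟨r, rfl⟩ := Submodule.mkQ_surjective _ y
    have hr : a.mkQ r = r • a.mkQ 1 := by rw [← map_smul, smul_eq_mul, mul_one]
    rw [hr, map_smul, map_smul]
    exact congrArg (r • ·) (congrArg Subtype.val h)
  · intro h
    refine hM.mem_of_torsion _ (gammaSubmodule_gammaSubmodule a) ?_
    let ev : Submodule.torsionBySet R (gammaSubmodule a X) (a : Set R) →ₗ[R]
        ((R ⧸ a) →ₗ[R] X) :=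
      { toFun x := Submodule.liftQ a (LinearMap.toSpanSingleton R X x.1.1) fun r hr =>
          congrArg Subtype.val ((Submodule.mem_torsionBySet_iff _ _).1 x.2 ⟨r, hr⟩)
        map_add' x y := by
          refine LinearMap.ext fun z => ?_
          obtain ⟨r, rfl⟩ := Submodule.mkQ_surjective _ z
          exact smul_add r x.1.1 y.1.1
        map_smul' r x := by
          refine LinearMap.ext fun z => ?_
          obtain ⟨s, rfl⟩ := Submodule.mkQ_surjective _ z
          exact smul_comm s r x.1.1 }
    refine M.prop_of_linearMap_injective (f := e.symm.toLinearMap ∘ₗ ev) ?_ h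
    refine e.symm.injective.comp fun x y h => Subtype.ext (Subtype.ext ?_)
    exact (one_smul R _).symm.trans ((LinearMap.congr_fun h (a.mkQ 1)).trans (one_smul R _))

theorem IsMelkersson.exists_shift [IsNoetherianRing R] (X : ModuleCat.{u} R)
    (hX : M (ModuleCat.of R (gammaSubmodule a X))) :
    ∃ C : ModuleCat.{u} R, ∀ i,
      (M ((localCohomologyFunctor a (i + 1)).obj X) ↔ M ((localCohomologyFunctor a i).obj C)) ∧
      (M (extQuotient a (i + 1) X) ↔ M (extQuotient a i C)) := by
  have := hM.isSerre
  obtain ⟨J, f, hJ, hJ', hf⟩ := exists_injective_linearMap_of_gammaSubmodule_eq_bot a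
    (gammaSubmodule_quotient a X)
  refine ⟨ModuleCat.of R (J ⧸ LinearMap.range f), fun i => ⟨?_, ?_⟩⟩
  · obtain ⟨e₁⟩ := nonempty_localCohomology_iso_of_surjective a i (gammaSubmodule a X).mkQ
      (Submodule.mkQ_surjective _) (by simp)
    obtain ⟨e₂⟩ := nonempty_localCohomology_succ_iso a i hJ' hf
    exact M.prop_iff_of_iso (e₁ ≪≫ e₂)
  · have : Injective (quotientSequence f).X₂ := Module.injective_object_of_injective_module R J
    obtain ⟨e⟩ := nonempty_ext_succ_iso (shortExact_quotientSequence hf)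
      (ModuleCat.of R (R ⧸ a)) (ext_quotient_zero_eq_zero a hJ') i
    have hS := LinearMap.shortExact_shortComplexKer
      (Submodule.mkQ_surjective (gammaSubmodule a X))
    have hker : M (LinearMap.shortComplexKer (gammaSubmodule a X).mkQ).X₁ :=
      M.prop_of_linearMap_injective (f := Submodule.inclusion (Submodule.ker_mkQ _).le)
        (Submodule.inclusion_injective _) hX
    exact (prop_ext_iff_of_shortExact hS _
      (fun j => prop_ext_of_finite hker j (ModuleCat.of R (R ⧸ a))) (i + 1)).trans
      (M.prop_iff_of_iso e)

end Melkersson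

theorem proposition3p3 {R : Type u} [CommRing R] [IsNoetherianRing R] (a : Ideal R)
    (M : ObjectProperty (ModuleCat.{u} R)) (hM : IsMelkersson a M)
    (X : ModuleCat.{u} R) (n : ℕ) :
    (∀ i : ℕ, i ≤ n → M ((localCohomologyFunctor a i).obj X)) ↔
      (∀ i : ℕ, i ≤ n → M (extQuotient a i X)) := by
  have := hM.isSerre
  have hiff : ∀ X : ModuleCat.{u} R, M ((localCohomologyFunctor a 0).obj X) ↔
      M (ModuleCat.of R (gammaSubmodule a X)) := fun X =>
    (nonempty_localCohomology_zero_iso a X).elim fun e => M.prop_iff_of_iso e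
  have hsplit : ∀ (n : ℕ) (P : ℕ → Prop),
      (∀ i ≤ n + 1, P i) ↔ P 0 ∧ ∀ i ≤ n, P (i + 1) := fun n P =>
    ⟨fun h => ⟨h 0 (Nat.zero_le _), fun i hi => h _ (Nat.succ_le_succ hi)⟩, fun h i hi => by
      cases i with
      | zero => exact h.1
      | succ i => exact h.2 i (Nat.le_of_succ_le_succ hi)⟩
  induction n generalizing X with
  | zero =>
    simp only [Nat.le_zero, forall_eq]
    rw [hiff, hM.prop_gammaSubmodule_iff]
  | succ n ih =>
    rw [hsplit n fun i => M ((localCohomologyFunctor a i).obj X),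
      hsplit n fun i => M (extQuotient a i X), hiff, ← hM.prop_gammaSubmodule_iff]
    -- The degree 0 conditions agree and supply the hypothesis of the shift; the induction
    -- hypothesis is then used for `C`.
    refine and_congr_right fun hX => ?_
    obtain ⟨C, hC⟩ := hM.exists_shift X hX
    simpa only [(hC _).1, (hC _).2] using ih C
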